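/- For an integer $n\ge 1$, let $\sigma=(\sigma_1,\dots,\sigma_n)\in\{-1,1\}^n$ be distributed according to the Curie–Weiss model at the critical inverse temperature $\beta=1$, that is, $$\mathbb P(\sigma)=\frac1{Z}\exp\Big(\frac1n\sum_{1\le i<j\le n}\sigma_i\sigma_j\Big),$$ where $Z$ is the normalizing constant. Let $S_n=\sigma_1+\cdots+\sigma_n$ be the total spin and $W=W_n=S_n/n^{3/4}$. Let $Y$ be a real random variable with probability density $K\exp(-x^4/12)$, $x\in\mathbb R$, where $K$ is the normalizing constant. Then there is a universal constant $B>0$ (independent of $n$, $p$ and $z$) such that for every integer $n\ge1$ and every real $p\ge 3$ one has $$\left|\mathbb P(W\le z)-\mathbb P(Y\le z)\right|\le \frac{B^p\,p^{p/2}}{(1+|z|)^p\,n^{1/2}}\qquad\text{for all } z\in\mathbb R,$$ and moreover $$\mathbb E|W|^{2p}\le 20^{p/2}\,p^{p/2}.$$ -/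

import Mathlib

noncomputable section

open MeasureTheory

namespace CurieWeiss

/-- Every set of spin values is measurable. -/
instance instMeasurableSingletonClassSpin : MeasurableSingletonClass ℤˣ where
  measurableSet_singleton u :=
    ⟨{(u : ℤ)}, measurableSet_singleton _, by ext v; simp [Units.ext_iff]⟩

/-- Configurations of `n` spins; the units of `ℤ` are exactly `1` and `-1`. -/
abbrev Config (n : ℕ) : Type := Fin n → ℤˣ

/-- The real value, `1` or `-1`, of the spin at site `i`. -/
def spin {n : ℕ} (σ : Config n) (i : Fin n) : ℝ := ((σ i : ℤ) : ℝ)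

/-- The unnormalized Gibbs weight `exp ((β / n) ∑_{i < j} σ_i σ_j)`. -/
def weight (n : ℕ) (β : ℝ) (σ : Config n) : ℝ :=
  Real.exp (β / n * ∑ i : Fin n, ∑ j ∈ Finset.Ioi i, spin σ i * spin σ j)

/-- The normalizing constant `Z_β`. -/
def partitionFunction (n : ℕ) (β : ℝ) : ℝ := ∑ σ : Config n, weight n β σ

theorem weight_pos (n : ℕ) (β : ℝ) (σ : Config n) : 0 < weight n β σ := Real.exp_pos _

theorem partitionFunction_pos (n : ℕ) (β : ℝ) : 0 < partitionFunction n β :=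
  Finset.sum_pos (fun σ _ => weight_pos n β σ) Finset.univ_nonempty

/-- The Curie–Weiss distribution of the `n` spins at inverse temperature `β`. -/
def gibbs (n : ℕ) (β : ℝ) : PMF (Config n) :=
  PMF.ofFintype (fun σ => ENNReal.ofReal (weight n β σ / partitionFunction n β)) (by
    rw [← ENNReal.ofReal_sum_of_nonneg
      (fun σ _ => (div_pos (weight_pos n β σ) (partitionFunction_pos n β)).le),
      ← Finset.sum_div]
    change ENNReal.ofReal (partitionFunction n β / partitionFunction n β) = 1
    rw [div_self (partitionFunction_pos n β).ne', ENNReal.ofReal_one])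

/-- The total spin `S_n`. -/
def totalSpin {n : ℕ} (σ : Config n) : ℝ := ∑ i : Fin n, spin σ i

/-- The rescaled total spin `W = S_n / n^{3/4}`. -/
def W {n : ℕ} (σ : Config n) : ℝ := totalSpin σ / (n : ℝ) ^ (3 / 4 : ℝ)

/-- The critical (`β = 1`) Curie–Weiss probability measure on spin configurations. -/
def criticalMeasure (n : ℕ) : Measure (Config n) := (gibbs n 1).toMeasure

/-- The probability density `K exp (-x⁴ / 12)`, `K` being the normalizing constant. -/
def limitDensity (x : ℝ) : ℝ :=
  (∫ t : ℝ, Real.exp (-t ^ 4 / 12))⁻¹ * Real.exp (-x ^ 4 / 12)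

/-- The law of a real random variable `Y` with density `limitDensity`. -/
def limitLaw : Measure ℝ :=
  (volume : Measure ℝ).withDensity fun x => ENNReal.ofReal (limitDensity x)

end CurieWeiss

end

/-!
The argument compares the lattice weights of the total spin with the limiting density directly,
cell by cell.

If `k` spins are up, then `S = 2k - n`, and the law of `S` gives this value mass proportional to
`Q k = C(n, k) exp ((2k - n)² / (2n))`. With `m = S + 1` and `v = m / (n + 1)`, consecutive weights
satisfy `Q (k + 1) / Q k = (1 - v) / (1 + v) * exp (2m / n)`. As
`log ((1 - v) / (1 + v)) = -2v - 2v³/3 - O(v⁵)`, the linear terms cancel to leading order at the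
critical temperature, and the cubic term adds up to `-w⁴ / 12`, where `w = S / n^{3/4}`.
Induction outwards from the centre gives bounds free of Stirling's formula, for `q = Q / Q_centre`:
`q ≤ exp (w² / √n - w⁴ / 12)` for all `w` (`relWeight_le`), and
`q ≥ exp (-w⁴ / 12 - w⁶ / (12 √n))` for `4 w² ≤ √n` (`le_relWeight`). Outside this last range
`exp (-w⁴ / 12)` is itself of order `exp (-2w²) / √n`, so `|q - exp (-x⁴ / 12)|` is at most a
constant times `exp (-x²) / √n` throughout the cell of width `2 / n^{3/4}` around `w`
(`abs_relWeight_sub_quartic_le`).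

Summing over cells compares partial sums of the weights with integrals of `exp (-x⁴ / 12)`, both
below and above a cell boundary. For masses `A`, `A'` below and above in the lattice and `G`, `G'`
in the limit, `A / (A + A') - G / (G + G')` has numerator `(A - G) G' - G (A' - G')`; each summand
is a product of a lower-tail and an upper-tail quantity, hence has Gaussian decay on both sides
(`abs_lower_ratio_sub_limitCdf_le`). Moving from the cell boundary to `z` costs `O(n^{-3/4})`, and
a bound `C exp (-z² / 4) / √n` is stronger than the stated one, because
`y^p exp (-y² / 8) ≤ 2^p p^{p/2}` (`rpow_mul_exp_neg_le`).

For the moments, `|W|⁴ ≤ n` settles `n ≤ 20 p`. Otherwise `n ≥ 60`, and the upper bound on `q`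
yields `E exp (W⁴ / 24) ≤ 8` (`sum_relWeight_mul_exp_le`), which is enough since
`|w|^{2p} ≤ (12p / e)^{p/2} exp (w⁴ / 24)` and `8 ≤ (5e/3)^{p/2}` for `p ≥ 3`.
-/

noncomputable section

open MeasureTheory

namespace CurieWeiss

/-! ### Binomial weights: two-sided quartic bounds -/

/-- The total Gibbs weight, up to a factor depending only on `n`, of the configurations with exactly
`k` spins equal to `1`; their total spin is `2 * k - n`. -/
def binomWeight (n k : ℕ) : ℝ :=
  (n.choose k : ℝ) * Real.exp ((2 * (k : ℝ) - n) ^ 2 / (2 * n))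

theorem binomWeight_pos {n k : ℕ} (hk : k ≤ n) : 0 < binomWeight n k := by
  have := Nat.choose_pos hk
  unfold binomWeight; positivity

theorem binomWeight_symm {n k : ℕ} (hk : k ≤ n) : binomWeight n (n - k) = binomWeight n k := by
  unfold binomWeight
  rw [Nat.choose_symm hk, Nat.cast_sub hk]
  congr 3
  ring

/-- The ratio of consecutive weights, in the variable `v = (2k + 1 - n) / (n + 1)`. -/
theorem binomWeight_succ {n k : ℕ} (hn : 1 ≤ n) (hk : k < n) :
    binomWeight n (k + 1) = binomWeight n k *
      ((1 - (2 * k + 1 - n) / (n + 1)) / (1 + (2 * k + 1 - n) / (n + 1)) *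
        Real.exp (2 * (2 * k + 1 - n) / n)) := by
  have hn0 : (n : ℝ) ≠ 0 := by positivity
  have hexp : Real.exp ((2 * ((k + 1 : ℕ) : ℝ) - n) ^ 2 / (2 * n)) =
      Real.exp ((2 * (k : ℝ) - n) ^ 2 / (2 * n)) * Real.exp (2 * (2 * k + 1 - n) / n) := by
    rw [← Real.exp_add]
    congr 1
    push_cast
    field_simp
    ring
  have hfrac : (1 - (2 * (k : ℝ) + 1 - n) / (n + 1)) / (1 + (2 * k + 1 - n) / (n + 1)) =
      (n - k) / (k + 1) := by
    have h1 : (1 - (2 * (k : ℝ) + 1 - n) / (n + 1)) = 2 * (n - k) / (n + 1) := by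
      field_simp; ring
    have h2 : (1 + (2 * (k : ℝ) + 1 - n) / (n + 1)) = 2 * (k + 1) / (n + 1) := by
      field_simp; ring
    rw [h1, h2]
    field_simp
  have hch : ((n.choose (k + 1) : ℕ) : ℝ) = n.choose k * ((n - k) / (k + 1)) := by
    have h := Nat.choose_succ_right_eq n k
    have h' : ((n.choose (k + 1) : ℕ) : ℝ) * (k + 1) = n.choose k * (n - k) := by
      rw [← Nat.cast_sub hk.le]; exact_mod_cast h
    field_simp
    linarith
  unfold binomWeight
  rw [hexp, hfrac, hch]
  ring

theorem one_sub_div_one_add_le {v : ℝ} (h0 : 0 ≤ v) (h1 : v < 1) :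
    (1 - v) / (1 + v) ≤ Real.exp (-2 * v - 2 / 3 * v ^ 3) := by
  have h := Real.hasSum_log_sub_log_of_abs_lt_one (abs_lt.2 ⟨by linarith, h1⟩)
  have h2 := h.summable.sum_le_tsum (Finset.range 2) (fun i _ => by positivity)
  rw [h.tsum_eq] at h2
  simp only [Finset.sum_range_succ, Finset.sum_range_zero] at h2
  norm_num at h2
  rw [← Real.log_le_iff_le_exp (div_pos (by linarith) (by linarith)),
    Real.log_div (by linarith) (by linarith)]
  linarith

theorem le_one_sub_div_one_add {v : ℝ} (h0 : 0 ≤ v) (h1 : v ≤ 1 / 2) :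
    Real.exp (-2 * v - 2 / 3 * v ^ 3 - v ^ 5) ≤ (1 - v) / (1 + v) := by
  rw [← Real.le_log_iff_exp_le (div_pos (by linarith) (by linarith)),
    Real.log_div (by linarith) (by linarith)]
  let F : ℝ → ℝ := fun x => Real.log (1 - x) - Real.log (1 + x) + 2 * x + 2 / 3 * x ^ 3 + x ^ 5
  have hF : ∀ x ∈ Set.Icc (0 : ℝ) (1 / 2), HasDerivAt F
      (-1 / (1 - x) - 1 / (1 + x) + 2 + 2 * x ^ 2 + 5 * x ^ 4) x := by
    intro x hx
    have a := ((hasDerivAt_id x).const_sub 1).log (by simp; linarith [hx.2])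
    have b := ((hasDerivAt_id x).const_add 1).log (by simp; linarith [hx.1])
    have c := (((a.sub b).add ((hasDerivAt_id x).const_mul 2)).add
      ((hasDerivAt_pow 3 x).const_mul (2 / 3))).add (hasDerivAt_pow 5 x)
    refine c.congr_deriv ?_
    simp only [id]
    push_cast
    ring
  have hmono : MonotoneOn F (Set.Icc 0 (1 / 2)) := by
    apply monotoneOn_of_deriv_nonneg (convex_Icc _ _)
    · exact fun x hx => (hF x hx).continuousAt.continuousWithinAt
    · exact fun x hx => (hF x (interior_subset hx)).differentiableAt.differentiableWithinAt
    · intro x hx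
      have hx' := interior_subset hx
      rw [(hF x hx').deriv]
      have p1 : 0 < 1 - x := by linarith [hx'.2]
      have p2 : 0 < 1 + x := by linarith [hx'.1]
      have e : -1 / (1 - x) - 1 / (1 + x) + 2 + 2 * x ^ 2 + 5 * x ^ 4 =
          x ^ 4 * (3 - 5 * x ^ 2) / ((1 - x) * (1 + x)) := by
        field_simp; ring
      rw [e]
      have : 0 ≤ 3 - 5 * x ^ 2 := by nlinarith [hx'.1, hx'.2]
      positivity
  have h := hmono ⟨le_rfl, by norm_num⟩ ⟨h0, h1⟩ h0
  simp only [F] at h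
  norm_num at h
  linarith

/-- The weight at the smallest nonnegative value of the total spin, `0` or `1` according to the
parity of `n`. -/
def centralWeight (n : ℕ) : ℝ := binomWeight n ((n + 1) / 2)

theorem centralWeight_pos (n : ℕ) : 0 < centralWeight n := binomWeight_pos (by omega)

/-- Upper bound on the half-line of nonnegative total spin, by induction away from the centre: the
exponent's increment dominates the logarithm of the ratio in `binomWeight_succ`. -/
theorem binomWeight_le_aux {n k : ℕ} (hn : 1 ≤ n) (hk0 : (n + 1) / 2 ≤ k) : k ≤ n →
    binomWeight n k ≤ centralWeight n *
      Real.exp ((2 * (k : ℝ) - n) ^ 2 / n ^ 2 - (2 * k - n) ^ 4 / (12 * n ^ 3)) := by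
  have hnR : (1 : ℝ) ≤ n := by exact_mod_cast hn
  induction k, hk0 using Nat.le_induction with
  | base =>
    intro _
    refine le_mul_of_one_le_right (centralWeight_pos n).le (Real.one_le_exp ?_)
    have hs : (2 * (((n + 1) / 2 : ℕ) : ℝ) - n) ^ 2 ≤ 1 := by
      have h1 : 2 * ((n + 1) / 2) ≤ n + 1 := by omega
      have h2 : n ≤ 2 * ((n + 1) / 2) := by omega
      have h1' : 2 * (((n + 1) / 2 : ℕ) : ℝ) ≤ n + 1 := by exact_mod_cast h1
      have h2' : (n : ℝ) ≤ 2 * (((n + 1) / 2 : ℕ) : ℝ) := by exact_mod_cast h2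
      nlinarith
    set s := 2 * (((n + 1) / 2 : ℕ) : ℝ) - n
    have : s ^ 2 / n ^ 2 - s ^ 4 / (12 * n ^ 3) = s ^ 2 * (12 * n - s ^ 2) / (12 * n ^ 3) := by
      field_simp
    rw [this]
    have : 0 ≤ 12 * n - s ^ 2 := by linarith
    positivity
  | succ k hk ih =>
    intro hkn
    have ih := ih (by omega)
    rw [binomWeight_succ hn (by omega)]
    have hm0 : (0 : ℝ) ≤ 2 * k + 1 - n := by
      have : n ≤ 2 * k + 1 := by omega
      have : (n : ℝ) ≤ 2 * k + 1 := by exact_mod_cast this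
      linarith
    have hm1 : (2 * k + 1 - n : ℝ) ≤ n - 1 := by
      have : (k : ℝ) + 1 ≤ n := by exact_mod_cast hkn
      linarith
    have hs : (2 * (k : ℝ) - n) = (2 * k + 1 - n) - 1 := by ring
    have hs2 : (2 * ((k + 1 : ℕ) : ℝ) - n) = (2 * k + 1 - n) + 1 := by push_cast; ring
    rw [hs] at ih
    rw [hs2]
    set m : ℝ := 2 * k + 1 - n
    have hv0 : 0 ≤ m / (n + 1) := by positivity
    have hv1 : m / (n + 1) < 1 := by rw [div_lt_one (by positivity)]; linarith
    have hr := one_sub_div_one_add_le hv0 hv1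
    have hr0 : 0 ≤ (1 - m / (n + 1)) / (1 + m / (n + 1)) :=
      div_nonneg (by linarith) (by linarith)
    calc _ ≤ (centralWeight n * Real.exp ((m - 1) ^ 2 / n ^ 2 - (m - 1) ^ 4 / (12 * n ^ 3))) *
          (Real.exp (-2 * (m / (n + 1)) - 2 / 3 * (m / (n + 1)) ^ 3) * Real.exp (2 * m / n)) := by
          have := centralWeight_pos n
          gcongr
      _ = centralWeight n * Real.exp (((m - 1) ^ 2 / n ^ 2 - (m - 1) ^ 4 / (12 * n ^ 3)) +
          (-2 * (m / (n + 1)) - 2 / 3 * (m / (n + 1)) ^ 3 + 2 * m / n)) := by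
          rw [Real.exp_add, Real.exp_add, mul_assoc]
      _ ≤ _ := by
          refine mul_le_mul_of_nonneg_left (Real.exp_le_exp.2 ?_) (centralWeight_pos n).le
          have hn0 : (0 : ℝ) < n := by linarith
          rw [← sub_nonneg]
          have e : (m + 1) ^ 2 / (n : ℝ) ^ 2 - (m + 1) ^ 4 / (12 * n ^ 3) -
              ((m - 1) ^ 2 / n ^ 2 - (m - 1) ^ 4 / (12 * n ^ 3) +
                (-2 * (m / (n + 1)) - 2 / 3 * (m / (n + 1)) ^ 3 + 2 * m / n)) =
              2 * m / (3 * n ^ 3 * (n + 1) ^ 3) *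
                ((6 * n - 1) * (n + 1) ^ 3 - 3 * n ^ 2 * (n + 1) ^ 2 -
                  m ^ 2 * (3 * n ^ 2 + 3 * n + 1)) := by
            field_simp; ring
          rw [e]
          have hm2 : m ^ 2 ≤ (n : ℝ) ^ 2 := by nlinarith
          have : 0 ≤ (6 * (n : ℝ) - 1) * (n + 1) ^ 3 - 3 * n ^ 2 * (n + 1) ^ 2 -
                  m ^ 2 * (3 * n ^ 2 + 3 * n + 1) := by
            have h3 : m ^ 2 * (3 * (n : ℝ) ^ 2 + 3 * n + 1) ≤ n ^ 2 * (3 * n ^ 2 + 3 * n + 1) := by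
              gcongr
            have : (6 * (n : ℝ) - 1) * (n + 1) ^ 3 - 3 * n ^ 2 * (n + 1) ^ 2 -
                  n ^ 2 * (3 * n ^ 2 + 3 * n + 1) = 8 * n ^ 3 + 11 * n ^ 2 + 3 * n - 1 := by ring
            nlinarith [pow_pos hn0 3, pow_pos hn0 2]
          positivity

/-- Lower bound for total spin in `[0, n / 2]`, where `v ≤ 1 / 2` at each step of the induction. -/
theorem le_binomWeight_aux {n k : ℕ} (hn : 1 ≤ n) (hk0 : (n + 1) / 2 ≤ k) : k ≤ n →
    2 * (k : ℝ) - n ≤ n / 2 → centralWeight n *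
      Real.exp (-(2 * (k : ℝ) - n) ^ 4 / (12 * n ^ 3) - (2 * k - n) ^ 6 / (12 * n ^ 5)) ≤
      binomWeight n k := by
  have hnR : (1 : ℝ) ≤ n := by exact_mod_cast hn
  induction k, hk0 using Nat.le_induction with
  | base =>
    intro _ _
    refine mul_le_of_le_one_right (centralWeight_pos n).le (Real.exp_le_one_iff.2 ?_)
    set s := 2 * (((n + 1) / 2 : ℕ) : ℝ) - n
    rw [neg_div, sub_nonpos]
    have a : 0 ≤ s ^ 4 / (12 * n ^ 3) := by positivity
    have b : 0 ≤ s ^ 6 / (12 * n ^ 5) := by positivity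
    linarith
  | succ k hk ih =>
    intro hkn hkh
    have hm0 : (0 : ℝ) ≤ 2 * k + 1 - n := by
      have : n ≤ 2 * k + 1 := by omega
      have : (n : ℝ) ≤ 2 * k + 1 := by exact_mod_cast this
      linarith
    have hs : (2 * (k : ℝ) - n) = (2 * k + 1 - n) - 1 := by ring
    have hs2 : (2 * ((k + 1 : ℕ) : ℝ) - n) = (2 * k + 1 - n) + 1 := by push_cast; ring
    rw [hs2] at hkh
    have ih := ih (by omega) (by linarith)
    rw [binomWeight_succ hn (by omega)]
    rw [hs] at ih
    rw [hs2]
    set m : ℝ := 2 * k + 1 - n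
    have hv0 : 0 ≤ m / (n + 1) := by positivity
    have hv1 : m / (n + 1) ≤ 1 / 2 := by rw [div_le_iff₀ (by positivity)]; linarith
    have hr := le_one_sub_div_one_add hv0 hv1
    have hQ := (binomWeight_pos (show k ≤ n by omega)).le
    calc _ ≤ centralWeight n * Real.exp ((-(m - 1) ^ 4 / (12 * n ^ 3) -
            (m - 1) ^ 6 / (12 * n ^ 5)) + (-2 * (m / (n + 1)) - 2 / 3 * (m / (n + 1)) ^ 3
              - (m / (n + 1)) ^ 5 + 2 * m / n)) := by
          refine mul_le_mul_of_nonneg_left (Real.exp_le_exp.2 ?_) (centralWeight_pos n).le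
          have hn0 : (0 : ℝ) < n := by linarith
          have h1 : m / (n + 1 : ℝ) ≤ m / n := by gcongr; linarith
          have h3 := pow_le_pow_left₀ hv0 h1 3
          have h5 := pow_le_pow_left₀ hv0 h1 5
          have e : -(m + 1) ^ 4 / (12 * (n : ℝ) ^ 3) - (m + 1) ^ 6 / (12 * n ^ 5) =
            -(m - 1) ^ 4 / (12 * n ^ 3) - (m - 1) ^ 6 / (12 * n ^ 5) - 2 / 3 * (m / n) ^ 3 -
              (m / n) ^ 5 - (2 / 3 * m / n ^ 3 + (10 * m ^ 3 + 3 * m) / (3 * n ^ 5)) := by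
            field_simp; ring
          have : 0 ≤ 2 / 3 * m / (n : ℝ) ^ 3 + (10 * m ^ 3 + 3 * m) / (3 * n ^ 5) := by positivity
          rw [e]
          have : 2 * m / n = 2 * (m / n) := by ring
          linarith
      _ = (centralWeight n * Real.exp (-(m - 1) ^ 4 / (12 * n ^ 3) -
            (m - 1) ^ 6 / (12 * n ^ 5))) * (Real.exp (-2 * (m / (n + 1)) - 2 / 3 * (m / (n + 1)) ^ 3
              - (m / (n + 1)) ^ 5) * Real.exp (2 * m / n)) := by
          rw [Real.exp_add, Real.exp_add, mul_assoc]
      _ ≤ _ := by gcongr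

theorem binomWeight_le {n k : ℕ} (hn : 1 ≤ n) (hk : k ≤ n) :
    binomWeight n k ≤ centralWeight n *
      Real.exp ((2 * (k : ℝ) - n) ^ 2 / n ^ 2 - (2 * k - n) ^ 4 / (12 * n ^ 3)) := by
  rcases le_or_gt ((n + 1) / 2) k with h | h
  · exact binomWeight_le_aux hn h hk
  · have := binomWeight_le_aux (k := n - k) hn (by omega) (by omega)
    rw [binomWeight_symm hk, Nat.cast_sub hk,
      show 2 * ((n : ℝ) - k) - n = -(2 * k - n) by ring, even_two.neg_pow,
      (by decide : Even 4).neg_pow] at this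
    exact this

theorem le_binomWeight {n k : ℕ} (hn : 1 ≤ n) (hk : k ≤ n) (hs : |2 * (k : ℝ) - n| ≤ n / 2) :
    centralWeight n *
      Real.exp (-(2 * (k : ℝ) - n) ^ 4 / (12 * n ^ 3) - (2 * k - n) ^ 6 / (12 * n ^ 5)) ≤
      binomWeight n k := by
  rw [abs_le] at hs
  rcases le_or_gt ((n + 1) / 2) k with h | h
  · exact le_binomWeight_aux hn h hk hs.2
  · have := le_binomWeight_aux (k := n - k) hn (by omega) (by omega)
      (by rw [Nat.cast_sub hk]; linarith)
    rw [binomWeight_symm hk, Nat.cast_sub hk,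
      show 2 * ((n : ℝ) - k) - n = -(2 * k - n) by ring, (by decide : Even 6).neg_pow,
      (by decide : Even 4).neg_pow] at this
    exact this

/-! ### Reduction of Gibbs averages to binomial sums -/

theorem spin_mul_self {n : ℕ} (σ : Config n) (i : Fin n) : spin σ i * spin σ i = 1 := by
  unfold spin
  rcases Int.units_eq_one_or (σ i) with h | h <;> simp [h]

/-- The interaction energy depends on the total spin alone. -/
theorem two_mul_sum_Ioi {n : ℕ} (σ : Config n) :
    2 * ∑ i : Fin n, ∑ j ∈ Finset.Ioi i, spin σ i * spin σ j = totalSpin σ ^ 2 - n := by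
  have h1 : totalSpin σ ^ 2 = ∑ i : Fin n, ∑ j : Fin n, spin σ i * spin σ j := by
    rw [sq, totalSpin, Finset.sum_mul_sum]
  have h2 : ∑ i : Fin n, ∑ j ∈ Finset.Ioi i, spin σ i * spin σ j =
      ∑ i : Fin n, ∑ j ∈ Finset.Iio i, spin σ i * spin σ j := by
    rw [Finset.sum_comm' (t' := Finset.univ) (s' := fun j => Finset.Iio j) (by simp)]
    exact Finset.sum_congr rfl fun i _ => Finset.sum_congr rfl fun j _ => mul_comm _ _
  have h3 : ∀ i : Fin n, ∑ j : Fin n, spin σ i * spin σ j =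
      ∑ j ∈ Finset.Iio i, spin σ i * spin σ j + 1 + ∑ j ∈ Finset.Ioi i, spin σ i * spin σ j := by
    intro i
    have hu : (Finset.univ : Finset (Fin n)) = (Finset.Iio i ∪ {i}) ∪ Finset.Ioi i := by
      ext j
      have := lt_trichotomy j i
      simp only [Finset.mem_univ, Finset.mem_union, Finset.mem_Iio, Finset.mem_singleton,
        Finset.mem_Ioi]
      tauto
    rw [hu, Finset.sum_union, Finset.sum_union, Finset.sum_singleton, spin_mul_self]
    · simp
    · rw [Finset.disjoint_left]
      intro j
      simp only [Finset.mem_union, Finset.mem_Iio, Finset.mem_singleton, Finset.mem_Ioi, not_lt]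
      rintro (h | h)
      · exact h.le
      · exact h.le
  rw [h1, Finset.sum_congr rfl fun i _ => h3 i, Finset.sum_add_distrib, Finset.sum_add_distrib,
    ← h2]
  simp
  ring

theorem weight_one_eq {n : ℕ} (hn : 1 ≤ n) (σ : Config n) :
    weight n 1 σ = Real.exp (-1 / 2) * Real.exp (totalSpin σ ^ 2 / (2 * n)) := by
  have hn0 : (n : ℝ) ≠ 0 := by positivity
  have h := two_mul_sum_Ioi σ
  rw [weight, ← Real.exp_add]
  congr 1
  field_simp
  linarith

/-- A configuration corresponds to the set of sites whose spin is `1`. -/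
def plusSites (n : ℕ) : Config n ≃ Finset (Fin n) where
  toFun σ := Finset.univ.filter fun i => σ i = 1
  invFun s i := if i ∈ s then 1 else -1
  left_inv σ := by
    funext i
    rcases Int.units_eq_one_or (σ i) with h | h <;> simp [h]
  right_inv s := by ext i; simp

theorem totalSpin_eq {n : ℕ} (σ : Config n) :
    totalSpin σ = 2 * ((plusSites n σ).card : ℝ) - n := by
  have h : ∀ i : Fin n, spin σ i = 2 * (if σ i = 1 then (1 : ℝ) else 0) - 1 := by
    intro i
    unfold spin
    rcases Int.units_eq_one_or (σ i) with h | h <;> simp [h]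
    norm_num
  simp only [totalSpin, h, Finset.sum_sub_distrib, ← Finset.mul_sum]
  simp [plusSites]

theorem sum_config {n : ℕ} (f : ℝ → ℝ) :
    ∑ σ : Config n, f (totalSpin σ) =
      ∑ k ∈ Finset.range (n + 1), (n.choose k : ℝ) * f (2 * k - n) := by
  simp only [totalSpin_eq]
  rw [(plusSites n).sum_comp (fun s => f (2 * (s.card : ℝ) - n)), ← Finset.powerset_univ,
    Finset.sum_powerset_apply_card (fun k => f (2 * (k : ℝ) - n))]
  simp

/-- The sum of all binomial weights; `partitionFunction n 1` up to the factor `exp (-1 / 2)`. -/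
def totalWeight (n : ℕ) : ℝ := ∑ k ∈ Finset.range (n + 1), binomWeight n k

theorem partitionFunction_one {n : ℕ} (hn : 1 ≤ n) :
    partitionFunction n 1 = Real.exp (-1 / 2) * totalWeight n := by
  simp only [partitionFunction, weight_one_eq hn, totalWeight, binomWeight]
  rw [← Finset.mul_sum, sum_config fun s => Real.exp (s ^ 2 / (2 * n))]

theorem integral_criticalMeasure {n : ℕ} (hn : 1 ≤ n) (f : ℝ → ℝ) :
    ∫ σ : Config n, f (totalSpin σ) ∂(criticalMeasure n) =
      (∑ k ∈ Finset.range (n + 1), binomWeight n k * f (2 * k - n)) / totalWeight n := by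
  rw [criticalMeasure, PMF.integral_eq_sum]
  have : ∀ σ : Config n, ((gibbs n 1) σ).toReal • f (totalSpin σ) =
      (fun s => (Real.exp (s ^ 2 / (2 * n)) * f s / totalWeight n)) (totalSpin σ) := by
    intro σ
    rw [gibbs, PMF.ofFintype_apply, ENNReal.toReal_ofReal
      (div_pos (weight_pos n 1 σ) (partitionFunction_pos n 1)).le, partitionFunction_one hn,
      weight_one_eq hn, mul_div_mul_left _ _ (Real.exp_pos _).ne', smul_eq_mul]
    ring
  rw [Finset.sum_congr rfl fun σ _ => this σ,
    sum_config fun s => Real.exp (s ^ 2 / (2 * n)) * f s / totalWeight n, Finset.sum_div]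
  refine Finset.sum_congr rfl fun k _ => ?_
  simp only [binomWeight]
  ring

theorem criticalMeasure_real_W_le {n : ℕ} (hn : 1 ≤ n) (z : ℝ) :
    (criticalMeasure n).real {σ | W σ ≤ z} =
      (∑ k ∈ (Finset.range (n + 1)).filter
        (fun k : ℕ => (2 * (k : ℝ) - n) / (n : ℝ) ^ (3 / 4 : ℝ) ≤ z), binomWeight n k) /
        totalWeight n := by
  classical
  have h := integral_criticalMeasure hn
    (fun s => if s / (n : ℝ) ^ (3 / 4 : ℝ) ≤ z then (1 : ℝ) else 0)
  rw [← integral_indicator_one (Set.toFinite _).measurableSet]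
  rw [Finset.sum_filter]
  simp only [mul_ite, mul_one, mul_zero] at h
  rw [← h]
  rfl

/-! ### Comparison of the weights with the limiting density -/

/-- The binomial weight relative to the central one. -/
def relWeight (n k : ℕ) : ℝ := binomWeight n k / centralWeight n

/-- The normalization `n^{3/4}` of the total spin. -/
def scale (n : ℕ) : ℝ := (n : ℝ) ^ (3 / 4 : ℝ)

/-- The value of `W` when exactly `k` spins equal `1`. -/
def level (n k : ℕ) : ℝ := (2 * (k : ℝ) - n) / scale n

theorem scale_pos {n : ℕ} (hn : 1 ≤ n) : 0 < scale n :=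
  Real.rpow_pos_of_pos (by exact_mod_cast hn) _

theorem scale_sq {n : ℕ} (hn : 1 ≤ n) : scale n ^ 2 = n * √n := by
  have hn0 : (0 : ℝ) < n := by exact_mod_cast hn
  rw [scale, ← Real.rpow_natCast, ← Real.rpow_mul hn0.le, Real.sqrt_eq_rpow]
  nth_rewrite 2 [← Real.rpow_one (n : ℝ)]
  rw [← Real.rpow_add hn0]
  norm_num

theorem one_le_sqrt_natCast {n : ℕ} (hn : 1 ≤ n) : 1 ≤ √(n : ℝ) :=
  Real.one_le_sqrt.2 (by exact_mod_cast hn)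

theorem sqrt_le_scale {n : ℕ} (hn : 1 ≤ n) : √(n : ℝ) ≤ scale n := by
  refine le_of_sq_le_sq ?_ (scale_pos hn).le
  rw [scale_sq hn, sq]
  have h1 := one_le_sqrt_natCast hn
  have : √(n : ℝ) ≤ n := by
    nth_rewrite 2 [← Real.mul_self_sqrt (Nat.cast_nonneg n)]
    nlinarith
  gcongr

theorem relWeight_pos {n k : ℕ} (hk : k ≤ n) : 0 < relWeight n k :=
  div_pos (binomWeight_pos hk) (centralWeight_pos n)

theorem level_mul_scale {n : ℕ} (hn : 1 ≤ n) (k : ℕ) :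
    2 * (k : ℝ) - n = level n k * scale n := by
  rw [level, div_mul_cancel₀ _ (scale_pos hn).ne']

theorem mul_scale_sq_div {n : ℕ} (hn : 1 ≤ n) (w : ℝ) : (w * scale n) ^ 2 / n ^ 2 = w ^ 2 / √n := by
  have hr := one_le_sqrt_natCast hn
  have hr2 := Real.sq_sqrt (Nat.cast_nonneg (α := ℝ) n)
  rw [mul_pow, scale_sq hn]
  generalize √(n : ℝ) = r at *
  rw [← hr2]
  field_simp

theorem mul_scale_pow_four_div {n : ℕ} (hn : 1 ≤ n) (w : ℝ) :
    (w * scale n) ^ 4 / (12 * n ^ 3) = w ^ 4 / 12 := by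
  have hr := one_le_sqrt_natCast hn
  have hr2 := Real.sq_sqrt (Nat.cast_nonneg (α := ℝ) n)
  rw [mul_pow, show scale n ^ 4 = (scale n ^ 2) ^ 2 by ring, scale_sq hn]
  generalize √(n : ℝ) = r at *
  rw [← hr2]
  field_simp

theorem mul_scale_pow_six_div {n : ℕ} (hn : 1 ≤ n) (w : ℝ) :
    (w * scale n) ^ 6 / (12 * n ^ 5) = w ^ 6 / (12 * √n) := by
  have hr := one_le_sqrt_natCast hn
  have hr2 := Real.sq_sqrt (Nat.cast_nonneg (α := ℝ) n)
  rw [mul_pow, show scale n ^ 6 = (scale n ^ 2) ^ 3 by ring, scale_sq hn]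
  generalize √(n : ℝ) = r at *
  rw [← hr2]
  field_simp

theorem relWeight_le {n k : ℕ} (hn : 1 ≤ n) (hk : k ≤ n) :
    relWeight n k ≤ Real.exp (level n k ^ 2 / √n - level n k ^ 4 / 12) := by
  have h := binomWeight_le hn hk
  rw [level_mul_scale hn, mul_scale_sq_div hn, mul_scale_pow_four_div hn] at h
  rwa [relWeight, div_le_iff₀' (centralWeight_pos n)]

theorem le_relWeight {n k : ℕ} (hn : 1 ≤ n) (hk : k ≤ n) (hw : 4 * level n k ^ 2 ≤ √n) :
    Real.exp (-level n k ^ 4 / 12 - level n k ^ 6 / (12 * √n)) ≤ relWeight n k := by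
  have hr := one_le_sqrt_natCast hn
  have hr2 := Real.sq_sqrt (Nat.cast_nonneg (α := ℝ) n)
  have hs : |2 * (k : ℝ) - n| ≤ n / 2 := by
    refine abs_le_of_sq_le_sq ?_ (by positivity)
    rw [level_mul_scale hn, mul_pow, scale_sq hn, div_pow]
    generalize √(n : ℝ) = r at *
    rw [← hr2]
    have : level n k ^ 2 * r ^ 2 * r * 4 ≤ r * (r ^ 2 * r) := by
      have : 0 ≤ r ^ 2 * r := by positivity
      nlinarith
    nlinarith
  have h := le_binomWeight hn hk hs
  rw [level_mul_scale hn, mul_scale_pow_six_div hn, neg_div, mul_scale_pow_four_div hn, ← neg_div] at h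
  rwa [relWeight, le_div_iff₀' (centralWeight_pos n)]

/-- The weight at a lattice point differs from `exp (-w⁴ / 12)` by `O(exp (-2w²) / √n)`. -/
theorem abs_relWeight_sub_le {n k : ℕ} (hn : 1 ≤ n) (hk : k ≤ n) :
    |relWeight n k - Real.exp (-level n k ^ 4 / 12)| ≤
      6 * Real.exp 48 / √n * Real.exp (-2 * level n k ^ 2) := by
  have hr := one_le_sqrt_natCast hn
  have hup := relWeight_le hn hk
  have hlow := le_relWeight hn hk
  have hq := relWeight_pos hk
  set w := level n k
  generalize √(n : ℝ) = r at *
  generalize relWeight n k = q at *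
  have hr0 : 0 < r := by linarith
  have ht : 0 ≤ w ^ 2 := sq_nonneg w
  have e4 : w ^ 4 = (w ^ 2) ^ 2 := by ring
  have e6 : w ^ 6 = (w ^ 2) ^ 3 := by ring
  rw [e4, e6] at hlow
  rw [e4] at hup ⊢
  generalize w ^ 2 = t at *
  have hg := Real.exp_pos (-t ^ 2 / 12)
  have e1 : t ≤ Real.exp t := by linarith [Real.add_one_le_exp t]
  have e3 : t ^ 3 ≤ 6 * Real.exp t := by
    have := Real.pow_div_factorial_le_exp t ht 3
    norm_num [Nat.factorial] at this
    linarith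
  have eone : 1 ≤ Real.exp t := Real.one_le_exp ht
  have key : |q - Real.exp (-t ^ 2 / 12)| ≤
      Real.exp (-t ^ 2 / 12) * (6 * (Real.exp t * Real.exp t) / r) := by
    rw [abs_le]
    constructor
    · rcases le_or_gt (4 * t) r with h | h
      · have h1 := hlow h
        rw [sub_eq_add_neg, Real.exp_add] at h1
        have h2 := Real.add_one_le_exp (-(t ^ 3 / (12 * r)))
        have h3 : t ^ 3 / (12 * r) ≤ 6 * (Real.exp t * Real.exp t) / r := by
          have hE : t ^ 3 ≤ 6 * (Real.exp t * Real.exp t) := by nlinarith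
          calc t ^ 3 / (12 * r) ≤ t ^ 3 / r := by gcongr; linarith
            _ ≤ _ := div_le_div_of_nonneg_right hE hr0.le
        nlinarith
      -- Here `1 < 4t / r`, so the density itself is below the claimed error.
      · have h3 : 1 ≤ 6 * (Real.exp t * Real.exp t) / r := by
          rw [one_le_div hr0]; nlinarith
        nlinarith
    · have h1 : Real.exp (t / r - t ^ 2 / 12) = Real.exp (-t ^ 2 / 12) * Real.exp (t / r) := by
        rw [← Real.exp_add]; congr 1; ring
      have h2 : Real.exp (t / r) - 1 ≤ t / r * Real.exp (t / r) := by
        have h := Real.add_one_le_exp (-(t / r))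
        rw [Real.exp_neg] at h
        have hp := Real.exp_pos (t / r)
        have := mul_le_mul_of_nonneg_right h hp.le
        rw [inv_mul_cancel₀ hp.ne'] at this
        linarith
      have h3 : t / r * Real.exp (t / r) ≤ 6 * (Real.exp t * Real.exp t) / r := by
        have : Real.exp (t / r) ≤ Real.exp t := Real.exp_le_exp.2 (div_le_self ht hr)
        rw [div_mul_eq_mul_div]
        refine div_le_div_of_nonneg_right ?_ hr0.le
        have := mul_le_mul e1 this (Real.exp_pos _).le (Real.exp_pos _).le
        nlinarith
      rw [h1] at hup
      nlinarith
  refine key.trans ?_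
  rw [mul_div_assoc', div_mul_eq_mul_div]
  refine div_le_div_of_nonneg_right ?_ hr0.le
  have : Real.exp (-t ^ 2 / 12) * (Real.exp t * Real.exp t) ≤
      Real.exp 48 * Real.exp (-2 * t) := by
    rw [← Real.exp_add, ← Real.exp_add, ← Real.exp_add, Real.exp_le_exp]
    nlinarith [sq_nonneg (t - 24)]
  linarith

theorem exp_neg_two_mul_sq_le {x y : ℝ} (h : |x - y| ≤ 1) :
    Real.exp (-2 * y ^ 2) ≤ Real.exp 2 * Real.exp (-x ^ 2) := by
  rw [← Real.exp_add, Real.exp_le_exp]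
  have : (x - y) ^ 2 ≤ 1 := by rw [← sq_abs]; exact pow_le_one₀ (abs_nonneg _) h
  nlinarith [sq_nonneg (x - 2 * y)]

theorem abs_quartic_sub_le {x y : ℝ} (h : |x - y| ≤ 1) :
    |Real.exp (-x ^ 4 / 12) - Real.exp (-y ^ 4 / 12)| ≤
      Real.exp 29 * Real.exp (-x ^ 2) * |x - y| := by
  have hd : ∀ ξ ∈ Set.uIcc y x, HasDerivWithinAt (fun u : ℝ => Real.exp (-u ^ 4 / 12))
      (Real.exp (-ξ ^ 4 / 12) * (-(ξ ^ 3 / 3))) (Set.uIcc y x) ξ := by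
    intro ξ _
    have := (((hasDerivAt_pow 4 ξ).neg).div_const 12).exp
    refine (this.congr_deriv ?_).hasDerivWithinAt
    push_cast
    simp only [Pi.neg_apply]
    ring
  refine (convex_uIcc y x).norm_image_sub_le_of_norm_hasDerivWithin_le hd (fun ξ hξ => ?_)
    Set.left_mem_uIcc Set.right_mem_uIcc
  have hξ1 : |x - ξ| ≤ 1 := by
    refine le_trans ?_ h
    rw [abs_sub_comm x y, abs_sub_comm x ξ]
    rw [Set.uIcc_comm] at hξ
    exact Set.abs_sub_left_of_mem_uIcc hξ
  rw [norm_mul, norm_neg, Real.norm_of_nonneg (Real.exp_pos _).le, Real.norm_eq_abs, abs_div,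
    abs_pow, abs_of_pos (by norm_num : (0 : ℝ) < 3)]
  have e4 : ξ ^ 4 = (ξ ^ 2) ^ 2 := by ring
  have h3 : |ξ| ^ 3 / 3 ≤ Real.exp (ξ ^ 2) := by
    have ht := sq_nonneg ξ
    have h1 : |ξ| ^ 3 ≤ ξ ^ 2 + (ξ ^ 2) ^ 2 := by
      rw [← sq_abs ξ]
      have := abs_nonneg ξ
      nlinarith [mul_nonneg (sq_nonneg |ξ|) (sq_nonneg (|ξ| - 1))]
    have h2 := Real.add_one_le_exp (ξ ^ 2)
    have h2' := Real.pow_div_factorial_le_exp (ξ ^ 2) ht 2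
    norm_num [Nat.factorial] at h2'
    linarith
  calc _ ≤ Real.exp (-ξ ^ 4 / 12) * Real.exp (ξ ^ 2) := by gcongr
    _ ≤ Real.exp 27 * Real.exp (-2 * ξ ^ 2) := by
      rw [← Real.exp_add, ← Real.exp_add, Real.exp_le_exp, e4]
      nlinarith [sq_nonneg (ξ ^ 2 - 18)]
    _ ≤ Real.exp 27 * (Real.exp 2 * Real.exp (-x ^ 2)) := by
      gcongr; exact exp_neg_two_mul_sq_le hξ1
    _ = _ := by rw [← mul_assoc, ← Real.exp_add]; norm_num

/-- The comparison of `abs_relWeight_sub_le` extended from the lattice point to its whole cell. -/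
theorem abs_relWeight_sub_quartic_le {n k : ℕ} (hn : 1 ≤ n) (hk : k ≤ n) {x : ℝ}
    (hx : |x - level n k| ≤ 1 / scale n) :
    |relWeight n k - Real.exp (-x ^ 4 / 12)| ≤ 7 * Real.exp 50 / √n * Real.exp (-x ^ 2) := by
  have hr := one_le_sqrt_natCast hn
  have hx' : |x - level n k| ≤ 1 / √n :=
    hx.trans (one_div_le_one_div_of_le (by linarith) (sqrt_le_scale hn))
  have hx1 : |x - level n k| ≤ 1 := hx'.trans (by rw [div_le_one (by linarith)]; exact hr)
  have h1 := abs_relWeight_sub_le hn hk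
  have h2 := abs_quartic_sub_le hx1
  have h3 := exp_neg_two_mul_sq_le hx1
  have h4 := abs_sub_le (relWeight n k) (Real.exp (-level n k ^ 4 / 12)) (Real.exp (-x ^ 4 / 12))
  rw [abs_sub_comm (Real.exp (-level n k ^ 4 / 12))] at h4
  calc _ ≤ _ := h4
    _ ≤ 6 * Real.exp 48 / √n * (Real.exp 2 * Real.exp (-x ^ 2)) +
        Real.exp 50 * Real.exp (-x ^ 2) * (1 / √n) := by
      refine add_le_add (h1.trans (by gcongr)) (h2.trans ?_)
      gcongr
      norm_num
    _ = _ := by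
      rw [show (50 : ℝ) = 48 + 2 by norm_num, Real.exp_add]
      ring

/-! ### Riemann sums, tails and the total mass -/

theorem integrable_gauss : Integrable fun x : ℝ => Real.exp (-x ^ 2) := by
  simpa using integrable_exp_neg_mul_sq (b := 1) one_pos

theorem quartic_le (x : ℝ) : Real.exp (-x ^ 4 / 12) ≤ Real.exp 3 * Real.exp (-x ^ 2) := by
  rw [← Real.exp_add, Real.exp_le_exp]
  nlinarith [sq_nonneg (x ^ 2 - 6)]

theorem integrable_quartic : Integrable fun x : ℝ => Real.exp (-x ^ 4 / 12) :=
  (integrable_gauss.const_mul (Real.exp 3)).mono' (by fun_prop)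
    (ae_of_all _ fun x => by
      rw [Real.norm_of_nonneg (Real.exp_pos _).le]
      exact quartic_le x)

theorem integral_quartic_pos : 0 < ∫ x : ℝ, Real.exp (-x ^ 4 / 12) := by
  rw [integral_pos_iff_support_of_nonneg (fun x => (Real.exp_pos _).le) integrable_quartic]
  have : Function.support (fun x : ℝ => Real.exp (-x ^ 4 / 12)) = Set.univ := by
    ext x; simp [(Real.exp_pos _).ne']
  simp [this]

/-- The factor in front of `exp (-x²)` in the cellwise comparison of weight and density. -/
def approxError (n : ℕ) : ℝ := 7 * Real.exp 50 / √n

theorem approxError_nonneg (n : ℕ) : 0 ≤ approxError n := by unfold approxError; positivity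

/-- Beyond the range `|x| < n / scale n = n^{1/4}` of `W`, the limiting density obeys the same bound as
the approximation error. -/
theorem quartic_le_of_natCast_div_scale_le {n : ℕ} (hn : 1 ≤ n) {x : ℝ}
    (hx : n / scale n ≤ |x|) :
    Real.exp (-x ^ 4 / 12) ≤ approxError n * Real.exp (-x ^ 2) := by
  have hr := one_le_sqrt_natCast hn
  have hx2 : √n ≤ x ^ 2 := by
    have h := pow_le_pow_left₀ (by have := scale_pos hn; positivity) hx 2
    rw [sq_abs, div_pow, scale_sq hn] at h
    have : (n : ℝ) ^ 2 / (n * √n) = √n := by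
      have hr2 := Real.sq_sqrt (Nat.cast_nonneg (α := ℝ) n)
      generalize √(n : ℝ) = r at *
      rw [← hr2]
      field_simp
    rwa [this] at h
  have h1 : Real.exp (-x ^ 2) ≤ 1 / √n := by
    rw [Real.exp_neg, ← one_div]
    exact one_div_le_one_div_of_le (by linarith) (by linarith [Real.add_one_le_exp (x ^ 2)])
  have h2 : Real.exp (-x ^ 4 / 12) ≤ Real.exp 50 * Real.exp (-x ^ 2) * Real.exp (-x ^ 2) := by
    rw [← Real.exp_add, ← Real.exp_add, Real.exp_le_exp]
    nlinarith [sq_nonneg (x ^ 2 - 12)]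
  calc _ ≤ _ := h2
    _ ≤ Real.exp 50 * (1 / √n) * Real.exp (-x ^ 2) := by gcongr
    _ ≤ _ := by
      unfold approxError
      rw [mul_one_div]
      gcongr
      linarith [Real.exp_pos 50]

/-- The midpoint between the lattice points `level n (j - 1)` and `level n j`; the cell of `level n j` is
`[edge n j, edge n (j + 1)]`. -/
def edge (n j : ℕ) : ℝ := (2 * (j : ℝ) - n - 1) / scale n

theorem edge_succ_sub {n j : ℕ} : edge n (j + 1) - edge n j = 2 / scale n := by
  unfold edge; push_cast; ring

theorem edge_eq {n j : ℕ} : edge n j = level n j - 1 / scale n := by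
  unfold edge level; ring

theorem edge_succ_eq {n j : ℕ} : edge n (j + 1) = level n j + 1 / scale n := by
  unfold edge level; push_cast; ring

theorem edge_mono {n : ℕ} (hn : 1 ≤ n) : Monotone (edge n) := by
  intro i j h
  have := scale_pos hn
  have : (i : ℝ) ≤ j := by exact_mod_cast h
  unfold edge
  gcongr

theorem level_mono {n : ℕ} (hn : 1 ≤ n) : Monotone (level n) := by
  intro i j h
  have := scale_pos hn
  have : (i : ℝ) ≤ j := by exact_mod_cast h
  unfold level
  gcongr

theorem abs_relWeight_sub_integral_le {n k : ℕ} (hn : 1 ≤ n) (hk : k ≤ n) :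
    |2 / scale n * relWeight n k - ∫ x in edge n k..edge n (k + 1), Real.exp (-x ^ 4 / 12)| ≤
      approxError n * ∫ x in edge n k..edge n (k + 1), Real.exp (-x ^ 2) := by
  have hle := edge_mono hn k.le_succ
  have h1 : 2 / scale n * relWeight n k = ∫ _ in edge n k..edge n (k + 1), relWeight n k := by
    rw [intervalIntegral.integral_const, edge_succ_sub, smul_eq_mul]
  rw [h1, ← intervalIntegral.integral_sub (by simp) integrable_quartic.intervalIntegrable,
    ← intervalIntegral.integral_const_mul]
  refine (intervalIntegral.abs_integral_le_integral_abs hle).trans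
    (intervalIntegral.integral_mono_on hle ?_ ?_ fun x hx => ?_)
  · exact Continuous.intervalIntegrable (by fun_prop) _ _
  · exact Continuous.intervalIntegrable (by fun_prop) _ _
  · refine abs_relWeight_sub_quartic_le hn hk ?_
    rw [edge_eq, edge_succ_eq] at hx
    rw [abs_le]
    constructor <;> linarith [hx.1, hx.2]

theorem abs_sum_relWeight_sub_integral_le {n i j : ℕ} (hn : 1 ≤ n) (hij : i ≤ j)
    (hj : j ≤ n + 1) :
    |2 / scale n * ∑ k ∈ Finset.Ico i j, relWeight n k -
        ∫ x in edge n i..edge n j, Real.exp (-x ^ 4 / 12)| ≤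
      approxError n * ∫ x in edge n i..edge n j, Real.exp (-x ^ 2) := by
  rw [← intervalIntegral.sum_integral_adjacent_intervals_Ico hij
      fun k _ => integrable_quartic.intervalIntegrable,
    ← intervalIntegral.sum_integral_adjacent_intervals_Ico hij
      fun k _ => integrable_gauss.intervalIntegrable,
    Finset.mul_sum, Finset.mul_sum, ← Finset.sum_sub_distrib]
  refine (Finset.abs_sum_le_sum_abs _ _).trans (Finset.sum_le_sum fun k hk => ?_)
  rw [Finset.mem_Ico] at hk
  exact abs_relWeight_sub_integral_le hn (by omega)

theorem setIntegral_quartic_le {n : ℕ} (hn : 1 ≤ n) {s : Set ℝ} (hs : MeasurableSet s)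
    (h : ∀ x ∈ s, n / scale n ≤ |x|) :
    ∫ x in s, Real.exp (-x ^ 4 / 12) ≤ approxError n * ∫ x in s, Real.exp (-x ^ 2) := by
  rw [← integral_const_mul]
  exact setIntegral_mono_on integrable_quartic.integrableOn
    (integrable_gauss.const_mul _).integrableOn hs
    fun x hx => quartic_le_of_natCast_div_scale_le hn (h x hx)

theorem natCast_div_scale_le_of_le {n : ℕ} {x : ℝ} (h : x ≤ level n 0) :
    n / scale n ≤ |x| := by
  refine le_trans ?_ (neg_le_abs x)
  have : level n 0 = -(n / scale n) := by simp [level, neg_div]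
  linarith

theorem natCast_div_scale_le_of_ge {n : ℕ} {x : ℝ} (h : level n n ≤ x) :
    n / scale n ≤ |x| := by
  refine le_trans ?_ (le_abs_self x)
  have : level n n = n / scale n := by unfold level; congr 1; ring
  linarith

theorem abs_lower_sum_sub_le {n j : ℕ} (hn : 1 ≤ n) (hj : j ≤ n + 1) :
    |2 / scale n * ∑ k ∈ Finset.range j, relWeight n k -
        ∫ x in Set.Iic (edge n j), Real.exp (-x ^ 4 / 12)| ≤
      approxError n * ∫ x in Set.Iic (edge n j), Real.exp (-x ^ 2) := by
  have hsc := scale_pos hn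
  have h0 := abs_sum_relWeight_sub_integral_le hn (Nat.zero_le j) hj
  rw [← intervalIntegral.integral_Iic_sub_Iic integrable_quartic.integrableOn
    integrable_quartic.integrableOn, ← intervalIntegral.integral_Iic_sub_Iic
    integrable_gauss.integrableOn integrable_gauss.integrableOn, ← Finset.range_eq_Ico] at h0
  have h1 := setIntegral_quartic_le hn (measurableSet_Iic (a := edge n 0)) fun x hx =>
    natCast_div_scale_le_of_le (le_trans hx (by rw [edge_eq]; linarith [one_div_pos.2 hsc]))
  have h2 : 0 ≤ ∫ x in Set.Iic (edge n 0), Real.exp (-x ^ 4 / 12) :=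
    integral_nonneg fun _ => (Real.exp_pos _).le
  rw [abs_le] at h0 ⊢
  constructor <;> linarith [h0.1, h0.2]

theorem abs_upper_sum_sub_le {n j : ℕ} (hn : 1 ≤ n) (hj : j ≤ n + 1) :
    |2 / scale n * ∑ k ∈ Finset.Ico j (n + 1), relWeight n k -
        ∫ x in Set.Ioi (edge n j), Real.exp (-x ^ 4 / 12)| ≤
      approxError n * ∫ x in Set.Ioi (edge n j), Real.exp (-x ^ 2) := by
  have hsc := scale_pos hn
  have h0 := abs_sum_relWeight_sub_integral_le hn hj le_rfl
  have h3 := intervalIntegral.integral_interval_add_Ioi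
    (integrable_quartic.integrableOn (s := Set.Ioi (edge n j)))
    (integrable_quartic.integrableOn (s := Set.Ioi (edge n (n + 1))))
  have h4 := intervalIntegral.integral_interval_add_Ioi
    (integrable_gauss.integrableOn (s := Set.Ioi (edge n j)))
    (integrable_gauss.integrableOn (s := Set.Ioi (edge n (n + 1))))
  have h1 := setIntegral_quartic_le hn (measurableSet_Ioi (a := edge n (n + 1))) fun x hx =>
    natCast_div_scale_le_of_ge (le_trans (by rw [edge_succ_eq]; linarith [one_div_pos.2 hsc])
      (Set.mem_Ioi.1 hx).le)
  have h2 : 0 ≤ ∫ x in Set.Ioi (edge n (n + 1)), Real.exp (-x ^ 4 / 12) :=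
    integral_nonneg fun _ => (Real.exp_pos _).le
  rw [← h3, ← h4]
  rw [abs_le] at h0 ⊢
  constructor <;> linarith [h0.1, h0.2]

/-- The constant `∫ exp (-x² / 2)`, which bounds the Gaussian integrals below. -/
def gaussMass : ℝ := ∫ x : ℝ, Real.exp (-x ^ 2 / 2)

theorem integrable_gauss_half : Integrable fun x : ℝ => Real.exp (-x ^ 2 / 2) := by
  have := integrable_exp_neg_mul_sq (b := 1 / 2) (by norm_num)
  refine this.congr (ae_of_all _ fun x => ?_)
  ring_nf

theorem gaussMass_nonneg : 0 ≤ gaussMass := integral_nonneg fun _ => (Real.exp_pos _).le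

theorem setIntegral_gauss_le {s : Set ℝ} (hs : MeasurableSet s) {a : ℝ}
    (h : ∀ x ∈ s, a ^ 2 ≤ x ^ 2) :
    ∫ x in s, Real.exp (-x ^ 2) ≤ gaussMass * Real.exp (-a ^ 2 / 2) := by
  calc _ ≤ ∫ x in s, Real.exp (-x ^ 2 / 2) * Real.exp (-a ^ 2 / 2) := by
        refine setIntegral_mono_on integrable_gauss.integrableOn
          (integrable_gauss_half.mul_const _).integrableOn hs fun x hx => ?_
        rw [← Real.exp_add, Real.exp_le_exp]
        linarith [h x hx]
    _ ≤ ∫ x, Real.exp (-x ^ 2 / 2) * Real.exp (-a ^ 2 / 2) :=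
        setIntegral_le_integral (integrable_gauss_half.mul_const _)
          (ae_of_all _ fun x => by positivity)
    _ = _ := by rw [integral_mul_const, gaussMass]

/-- One of the two tails at `a` is always small, so their product decays on both sides. -/
theorem gauss_tails_mul_le (a : ℝ) :
    (∫ x in Set.Iic a, Real.exp (-x ^ 2)) * ∫ x in Set.Ioi a, Real.exp (-x ^ 2) ≤
      gaussMass ^ 2 * Real.exp (-a ^ 2 / 2) := by
  have hM := gaussMass_nonneg
  have hl : 0 ≤ ∫ x in Set.Iic a, Real.exp (-x ^ 2) := integral_nonneg fun _ => (Real.exp_pos _).le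
  have hu : 0 ≤ ∫ x in Set.Ioi a, Real.exp (-x ^ 2) := integral_nonneg fun _ => (Real.exp_pos _).le
  have hl1 := setIntegral_gauss_le (measurableSet_Iic (a := a)) (a := 0)
    (fun x _ => by simpa using sq_nonneg x)
  have hu1 := setIntegral_gauss_le (measurableSet_Ioi (a := a)) (a := 0)
    (fun x _ => by simpa using sq_nonneg x)
  norm_num at hl1 hu1
  rcases le_total a 0 with h | h
  · have := setIntegral_gauss_le (measurableSet_Iic (a := a)) (a := a)
      (fun x hx => by have := Set.mem_Iic.1 hx; nlinarith)
    calc _ ≤ (gaussMass * Real.exp (-a ^ 2 / 2)) * gaussMass := by gcongr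
      _ = _ := by ring
  · have := setIntegral_gauss_le (measurableSet_Ioi (a := a)) (a := a)
      (fun x hx => by have := Set.mem_Ioi.1 hx; nlinarith)
    calc _ ≤ gaussMass * (gaussMass * Real.exp (-a ^ 2 / 2)) := by gcongr
      _ = _ := by ring

theorem sum_relWeight_ge {n : ℕ} (hn : 16 ≤ n) :
    43 / 48 * (scale n - 1) ≤ ∑ k ∈ Finset.range (n + 1), relWeight n k := by
  have hn1 : 1 ≤ n := by omega
  have hsc := scale_pos hn1
  have h4 : 4 ≤ √(n : ℝ) := by
    rw [Real.le_sqrt (by norm_num) (by positivity)]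
    have : (16 : ℝ) ≤ n := by exact_mod_cast hn
    norm_num; linarith
  have hscn : scale n ≤ n := by
    refine le_of_sq_le_sq ?_ (by positivity)
    rw [scale_sq hn1, sq]
    gcongr
    nlinarith [Real.mul_self_sqrt (Nat.cast_nonneg (α := ℝ) n)]
  -- All indices in `[lo, hi]` have `|level n k| ≤ 1`.
  set lo := ⌈((n : ℝ) - scale n) / 2⌉₊
  set hi := ⌊((n : ℝ) + scale n) / 2⌋₊
  have hlo : (lo : ℝ) < ((n : ℝ) - scale n) / 2 + 1 := Nat.ceil_lt_add_one (by linarith)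
  have hhi : ((n : ℝ) + scale n) / 2 < hi + 1 := Nat.lt_floor_add_one _
  have hsub : Finset.Icc lo hi ⊆ Finset.range (n + 1) := by
    intro k hk
    rw [Finset.mem_Icc] at hk
    have : (k : ℝ) ≤ hi := by exact_mod_cast hk.2
    have h2 : (hi : ℝ) ≤ ((n : ℝ) + scale n) / 2 := Nat.floor_le (by positivity)
    have : (k : ℝ) ≤ n := by linarith
    have : k ≤ n := by exact_mod_cast this
    simp; omega
  have hcard : scale n - 1 ≤ (Finset.Icc lo hi).card := by
    rw [Nat.card_Icc]
    have : ((hi + 1 : ℕ) : ℝ) ≤ ((hi + 1 - lo : ℕ) : ℝ) + lo := by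
      exact_mod_cast (by omega : hi + 1 ≤ hi + 1 - lo + lo)
    push_cast at this
    linarith
  have hterm : ∀ k ∈ Finset.Icc lo hi, (43 / 48 : ℝ) ≤ relWeight n k := by
    intro k hk
    have hkn := Finset.mem_range.1 (hsub hk)
    rw [Finset.mem_Icc] at hk
    have h1 : ((n : ℝ) - scale n) / 2 ≤ k := (Nat.le_ceil _).trans (by exact_mod_cast hk.1)
    have h2 : (k : ℝ) ≤ ((n : ℝ) + scale n) / 2 :=
      le_trans (by exact_mod_cast hk.2) (Nat.floor_le (by positivity))
    have hw : level n k ^ 2 ≤ 1 := by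
      rw [sq_le_one_iff_abs_le_one, level, abs_div, abs_of_pos hsc, div_le_one hsc, abs_le]
      constructor <;> linarith
    refine le_trans ?_ (le_relWeight hn1 (by omega) (by linarith))
    have e4 : level n k ^ 4 ≤ 1 := by nlinarith [sq_nonneg (level n k)]
    have e6 : level n k ^ 6 ≤ 1 := by
      have := pow_le_one₀ (n := 3) (sq_nonneg (level n k)) hw
      rwa [← pow_mul] at this
    have e6' : level n k ^ 6 / (12 * √n) ≤ 1 / 48 := by
      rw [div_le_div_iff₀ (by positivity) (by norm_num)]; linarith
    have := Real.add_one_le_exp (-level n k ^ 4 / 12 - level n k ^ 6 / (12 * √n))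
    linarith
  calc 43 / 48 * (scale n - 1) ≤ ∑ k ∈ Finset.Icc lo hi, (43 / 48 : ℝ) := by
        rw [Finset.sum_const, nsmul_eq_mul]; linarith
    _ ≤ ∑ k ∈ Finset.Icc lo hi, relWeight n k := Finset.sum_le_sum hterm
    _ ≤ _ := Finset.sum_le_sum_of_subset_of_nonneg hsub fun k hk _ =>
        (relWeight_pos (by simpa [Nat.lt_succ_iff] using hk)).le

/-- A lower bound, uniform in `n`, on the Riemann sum for the total mass: for `n < 16` the central
weight suffices, since then `scale n ≤ 8`. -/
theorem quarter_le_mass {n : ℕ} (hn : 1 ≤ n) :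
    1 / 4 ≤ 2 / scale n * ∑ k ∈ Finset.range (n + 1), relWeight n k := by
  have hsc := scale_pos hn
  rw [div_mul_eq_mul_div, le_div_iff₀ hsc]
  have hsq := scale_sq hn
  rcases le_or_gt 16 n with h | h
  · have h1 := sum_relWeight_ge h
    have h2 : (4 : ℝ) ≤ scale n := by
      refine le_trans ?_ (sqrt_le_scale hn)
      rw [Real.le_sqrt (by norm_num) (by positivity)]
      have : (16 : ℝ) ≤ n := by exact_mod_cast h
      norm_num; linarith
    linarith
  · have h1 : (1 : ℝ) ≤ ∑ k ∈ Finset.range (n + 1), relWeight n k := by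
      have : relWeight n ((n + 1) / 2) = 1 := div_self (centralWeight_pos n).ne'
      rw [← this]
      exact Finset.single_le_sum (f := relWeight n)
        (fun k hk => (relWeight_pos (by simpa [Nat.lt_succ_iff] using hk)).le) (by simp; omega)
    have h2 : scale n ≤ 8 := by
      refine le_of_sq_le_sq ?_ (by norm_num)
      have hn16 : (n : ℝ) ≤ 16 := by exact_mod_cast h.le
      have : √(n : ℝ) ≤ 4 := Real.sqrt_le_iff.2 ⟨by norm_num, by linarith⟩
      rw [hsq]
      nlinarith [Real.sqrt_nonneg (n : ℝ)]
    linarith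

/-! ### The bound on the distribution functions -/

/-- Comparison of the lower proportions `A / (A + B)` and `G / (G + G')`. The error contains the product
`H * H'` of the lower and upper controls, and so is small as soon as one of them is. -/
theorem abs_ratio_sub_ratio_le {A B G G' H H' ε c : ℝ} (hε : 0 ≤ ε) (hc : 0 ≤ c)
    (hG : 0 ≤ G) (hG' : 0 ≤ G') (hH : 0 ≤ H) (hGH : G ≤ c * H) (hGH' : G' ≤ c * H')
    (hpos : 0 < G + G') (hAB : 1 / 4 ≤ A + B)
    (hA : |A - G| ≤ ε * H) (hB : |B - G'| ≤ ε * H') :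
    |A / (A + B) - G / (G + G')| ≤ 8 * c / (G + G') * ε * (H * H') := by
  have hAB0 : 0 < A + B := by linarith
  have h1 : |(A - G) * G' - G * (B - G')| ≤ 2 * c * ε * (H * H') := by
    refine (abs_sub _ _).trans ?_
    rw [abs_mul, abs_mul, abs_of_nonneg hG, abs_of_nonneg hG']
    have := mul_le_mul hA hGH' hG' (by positivity)
    have := mul_le_mul hGH hB (abs_nonneg _) (by positivity)
    linarith
  have e : A / (A + B) - G / (G + G') = ((A - G) * G' - G * (B - G')) / ((A + B) * (G + G')) := by
    field_simp; ring
  have hX : 0 ≤ 2 * c * ε * (H * H') := (abs_nonneg _).trans h1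
  rw [e, abs_div, abs_of_pos (mul_pos hAB0 hpos), div_le_iff₀ (by positivity)]
  have e2 : 8 * c / (G + G') * ε * (H * H') * ((A + B) * (G + G')) =
      (2 * c * ε * (H * H')) * (4 * (A + B)) := by
    field_simp; ring
  rw [e2]
  nlinarith

/-- The distribution function of the limit law. -/
def limitCdf (z : ℝ) : ℝ :=
  (∫ x in Set.Iic z, Real.exp (-x ^ 4 / 12)) / ∫ x : ℝ, Real.exp (-x ^ 4 / 12)

theorem limitLaw_real_Iic (z : ℝ) : limitLaw.real (Set.Iic z) = limitCdf z := by
  have hnn : ∀ x, 0 ≤ limitDensity x := fun x => by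
    unfold limitDensity; have := integral_quartic_pos; positivity
  have hint : Integrable limitDensity := integrable_quartic.const_mul _
  rw [limitLaw, measureReal_def, withDensity_apply _ measurableSet_Iic,
    ← ofReal_integral_eq_lintegral_ofReal hint.integrableOn (ae_of_all _ hnn),
    ENNReal.toReal_ofReal (integral_nonneg hnn)]
  simp only [limitDensity]
  rw [integral_const_mul, limitCdf, div_eq_inv_mul]

theorem setIntegral_quartic_nonneg (s : Set ℝ) : 0 ≤ ∫ x in s, Real.exp (-x ^ 4 / 12) :=
  integral_nonneg fun _ => (Real.exp_pos _).le

theorem integral_quartic_Iic_add_Ioi (a : ℝ) :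
    (∫ x in Set.Iic a, Real.exp (-x ^ 4 / 12)) + ∫ x in Set.Ioi a, Real.exp (-x ^ 4 / 12) =
      ∫ x : ℝ, Real.exp (-x ^ 4 / 12) :=
  intervalIntegral.integral_Iic_add_Ioi integrable_quartic.integrableOn
    integrable_quartic.integrableOn

theorem setIntegral_quartic_le_gauss (s : Set ℝ) :
    ∫ x in s, Real.exp (-x ^ 4 / 12) ≤ Real.exp 3 * ∫ x in s, Real.exp (-x ^ 2) := by
  rw [← integral_const_mul]
  exact integral_mono integrable_quartic.integrableOn (integrable_gauss.const_mul _).integrableOn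
    fun x => quartic_le x

theorem abs_lower_ratio_sub_limitCdf_le {n j : ℕ} (hn : 1 ≤ n) (hj : j ≤ n + 1) :
    |(∑ k ∈ Finset.range j, relWeight n k) / (∑ k ∈ Finset.range (n + 1), relWeight n k) -
        limitCdf (edge n j)| ≤
      8 * Real.exp 3 / (∫ x : ℝ, Real.exp (-x ^ 4 / 12)) * approxError n *
        (gaussMass ^ 2 * Real.exp (-edge n j ^ 2 / 2)) := by
  have hsc := scale_pos hn
  have hA := abs_lower_sum_sub_le hn hj
  have hB := abs_upper_sum_sub_le hn hj
  have hsum : 2 / scale n * ∑ k ∈ Finset.range j, relWeight n k +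
      2 / scale n * ∑ k ∈ Finset.Ico j (n + 1), relWeight n k =
      2 / scale n * ∑ k ∈ Finset.range (n + 1), relWeight n k := by
    rw [← mul_add, Finset.sum_range_add_sum_Ico _ hj]
  have hadd := integral_quartic_Iic_add_Ioi (edge n j)
  have h := abs_ratio_sub_ratio_le (approxError_nonneg n) (Real.exp_pos 3).le
    (setIntegral_quartic_nonneg _) (setIntegral_quartic_nonneg _)
    (integral_nonneg fun _ => (Real.exp_pos _).le) (setIntegral_quartic_le_gauss _)
    (setIntegral_quartic_le_gauss _) (by rw [hadd]; exact integral_quartic_pos)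
    (by rw [hsum]; exact quarter_le_mass hn) hA hB
  rw [hsum, hadd, mul_div_mul_left _ _ (by positivity)] at h
  refine h.trans ?_
  have := gauss_tails_mul_le (edge n j)
  have := approxError_nonneg n
  have := integral_quartic_pos
  gcongr

/-- The lattice points in `(-∞, z]` form an initial segment of the indices. -/
theorem exists_level_le_iff_lt {n : ℕ} (hn : 1 ≤ n) (z : ℝ) :
    ∃ j ≤ n + 1, ∀ k ≤ n, level n k ≤ z ↔ k < j := by
  classical
  have hex : ∃ k, n < k ∨ z < level n k := ⟨n + 1, Or.inl n.lt_succ_self⟩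
  refine ⟨Nat.find hex, Nat.find_min' hex (Or.inl n.lt_succ_self), fun k hk => ⟨fun h => ?_,
    fun h => ?_⟩⟩
  · by_contra hlt
    push Not at hlt
    rcases Nat.find_spec hex with h1 | h1
    · omega
    · exact absurd (h1.trans_le (level_mono hn hlt)) (not_lt.2 h)
  · have := Nat.find_min hex h
    push Not at this
    exact this.2

theorem abs_limitCdf_sub_le {a z : ℝ} (h : |a - z| ≤ 1) :
    |limitCdf a - limitCdf z| ≤
      Real.exp 4 / (∫ x : ℝ, Real.exp (-x ^ 4 / 12)) * Real.exp (-z ^ 2 / 4) * |a - z| := by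
  have hpos := integral_quartic_pos
  rw [limitCdf, limitCdf, ← sub_div, intervalIntegral.integral_Iic_sub_Iic
    integrable_quartic.integrableOn integrable_quartic.integrableOn, abs_div, abs_of_pos hpos,
    div_le_iff₀ hpos]
  have h1 := intervalIntegral.norm_integral_le_of_norm_le_const (a := z) (b := a)
    (f := fun x : ℝ => Real.exp (-x ^ 4 / 12)) (C := Real.exp 4 * Real.exp (-z ^ 2 / 4))
    (fun x hx => by
      rw [Real.norm_of_nonneg (Real.exp_pos _).le]
      refine (quartic_le x).trans ?_
      rw [← Real.exp_add, ← Real.exp_add, Real.exp_le_exp]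
      have h2 : |x - z| ≤ 1 :=
        (Set.abs_sub_left_of_mem_uIcc (Set.uIoc_subset_uIcc hx)).trans h
      have : (x - z) ^ 2 ≤ 1 := by rw [← sq_abs]; exact pow_le_one₀ (abs_nonneg _) h2
      nlinarith [sq_nonneg (2 * x - z)])
  rw [Real.norm_eq_abs] at h1
  refine h1.trans (le_of_eq ?_)
  generalize (∫ x : ℝ, Real.exp (-x ^ 4 / 12)) = I at hpos
  field_simp

theorem exists_cdf_bound : ∃ C : ℝ, 0 < C ∧ ∀ n : ℕ, 1 ≤ n → ∀ z : ℝ,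
    |(criticalMeasure n).real {σ | W σ ≤ z} - limitLaw.real (Set.Iic z)| ≤
      C / √n * Real.exp (-z ^ 2 / 4) := by
  have hpos := integral_quartic_pos
  have hM := gaussMass_nonneg
  set I := ∫ x : ℝ, Real.exp (-x ^ 4 / 12)
  set C₁ := 8 * Real.exp 3 / I * (7 * Real.exp 50) * gaussMass ^ 2 * Real.exp (1 / 2)
  set C₂ := Real.exp 4 / I
  set C₃ := 7 * Real.exp 50 * gaussMass / I
  have hC₁ : 0 ≤ C₁ := by positivity
  have hC₂ : 0 < C₂ := by positivity
  have hC₃ : 0 ≤ C₃ := by positivity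
  refine ⟨C₁ + C₂ + C₃, by linarith, fun n hn z => ?_⟩
  have hr := one_le_sqrt_natCast hn
  have hsc := scale_pos hn
  have hbig : ∀ D, D ≤ C₁ + C₂ + C₃ → D / √n * Real.exp (-z ^ 2 / 4) ≤
      (C₁ + C₂ + C₃) / √n * Real.exp (-z ^ 2 / 4) := fun D hD => by gcongr
  have hrel : ∀ j, (∑ k ∈ Finset.range j, binomWeight n k) / totalWeight n =
      (∑ k ∈ Finset.range j, relWeight n k) / ∑ k ∈ Finset.range (n + 1), relWeight n k := by
    intro j
    simp only [relWeight, ← Finset.sum_div, totalWeight]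
    rw [div_div_div_cancel_right₀ (centralWeight_pos n).ne']
  have hrel_pos : 0 < ∑ k ∈ Finset.range (n + 1), relWeight n k :=
    Finset.sum_pos (fun k hk => relWeight_pos (by simpa [Nat.lt_succ_iff] using hk)) ⟨0, by simp⟩
  obtain ⟨j, hj, hlev⟩ := exists_level_le_iff_lt hn z
  have hfilter : (Finset.range (n + 1)).filter
      (fun k : ℕ => (2 * (k : ℝ) - n) / (n : ℝ) ^ (3 / 4 : ℝ) ≤ z) = Finset.range j := by
    ext k
    simp only [Finset.mem_filter, Finset.mem_range]
    constructor
    · rintro ⟨h1, h2⟩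
      exact (hlev k (by omega)).1 h2
    · exact fun h => ⟨by omega, (hlev k (by omega)).2 h⟩
  rw [criticalMeasure_real_W_le hn, hfilter, hrel, limitLaw_real_Iic]
  have htail : ∀ s : Set ℝ, MeasurableSet s → (∀ x ∈ s, n / scale n ≤ |x|) →
      (∀ x ∈ s, z ^ 2 ≤ x ^ 2) →
      (∫ x in s, Real.exp (-x ^ 4 / 12)) / I ≤ C₃ / √n * Real.exp (-z ^ 2 / 4) := by
    intro s hs h1 h2
    have h3 := setIntegral_quartic_le hn hs h1
    have h4 := setIntegral_gauss_le hs h2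
    have h5 : Real.exp (-z ^ 2 / 2) ≤ Real.exp (-z ^ 2 / 4) :=
      Real.exp_le_exp.2 (by linarith [sq_nonneg z])
    calc _ ≤ (approxError n * (gaussMass * Real.exp (-z ^ 2 / 4))) / I := by
          refine div_le_div_of_nonneg_right (h3.trans ?_) hpos.le
          exact mul_le_mul_of_nonneg_left (h4.trans (by gcongr)) (approxError_nonneg n)
      _ = _ := by simp only [approxError, C₃]; field_simp
  -- No lattice point lies in `(-∞, z]`, all of them do, or `z` is within `1 / scale n` of `edge n j`.
  rcases Nat.eq_zero_or_pos j with rfl | hj0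
  · have hz : z < level n 0 := by
      have := hlev 0 (by omega)
      simpa using this
    have h := htail (Set.Iic z) measurableSet_Iic
      (fun x hx => natCast_div_scale_le_of_le ((Set.mem_Iic.1 hx).trans hz.le))
      (fun x hx => by
        have h1 : level n 0 ≤ 0 := by
          simp only [level]; norm_num
          exact div_nonpos_of_nonpos_of_nonneg (by simp) hsc.le
        have := Set.mem_Iic.1 hx
        nlinarith)
    rw [Finset.range_zero, Finset.sum_empty, zero_div, zero_sub, abs_neg, limitCdf,
      abs_of_nonneg (div_nonneg (setIntegral_quartic_nonneg _) hpos.le)]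
    exact h.trans (hbig _ (by linarith))
  rcases hj.eq_or_lt with rfl | hjn
  · have hz : level n n ≤ z := (hlev n le_rfl).2 (by omega)
    have h := htail (Set.Ioi z) measurableSet_Ioi
      (fun x hx => natCast_div_scale_le_of_ge (hz.trans (Set.mem_Ioi.1 hx).le))
      (fun x hx => by
        have h1 : 0 ≤ level n n := div_nonneg (by linarith [Nat.cast_nonneg (α := ℝ) n]) hsc.le
        have := Set.mem_Ioi.1 hx
        nlinarith)
    have hadd := integral_quartic_Iic_add_Ioi z
    have e : 1 - limitCdf z = (∫ x in Set.Ioi z, Real.exp (-x ^ 4 / 12)) / I := by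
      rw [limitCdf, eq_div_iff hpos.ne', sub_mul, div_mul_cancel₀ _ hpos.ne']
      linarith
    rw [div_self hrel_pos.ne', e,
      abs_of_nonneg (div_nonneg (setIntegral_quartic_nonneg _) hpos.le)]
    exact h.trans (hbig _ (by linarith))
  · have hz1 : level n (j - 1) ≤ z := (hlev (j - 1) (by omega)).2 (by omega)
    have hz2 : z < level n j := by
      have := (hlev j (by omega)).not
      simpa using this
    have he1 := edge_eq (n := n) (j := j)
    have he2 := edge_succ_eq (n := n) (j := j - 1)
    rw [Nat.sub_add_cancel hj0] at he2
    have hd : |edge n j - z| ≤ 1 / √n := by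
      refine le_trans ?_ (one_div_le_one_div_of_le (by linarith) (sqrt_le_scale hn))
      rw [abs_le]
      constructor <;> linarith
    have hd1 : |edge n j - z| ≤ 1 := hd.trans (by rw [div_le_one (by linarith)]; exact hr)
    have h1 := abs_lower_ratio_sub_limitCdf_le hn hj
    have h2 := abs_limitCdf_sub_le hd1
    have h3 : Real.exp (-edge n j ^ 2 / 2) ≤ Real.exp (1 / 2) * Real.exp (-z ^ 2 / 4) := by
      rw [← Real.exp_add, Real.exp_le_exp]
      have : (edge n j - z) ^ 2 ≤ 1 := by rw [← sq_abs]; exact pow_le_one₀ (abs_nonneg _) hd1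
      nlinarith [sq_nonneg (2 * edge n j - z)]
    refine (abs_sub_le _ (limitCdf (edge n j)) _).trans ((add_le_add h1 h2).trans ?_)
    calc _ ≤ 8 * Real.exp 3 / I * approxError n *
          (gaussMass ^ 2 * (Real.exp (1 / 2) * Real.exp (-z ^ 2 / 4))) +
          Real.exp 4 / I * Real.exp (-z ^ 2 / 4) * (1 / √n) := by
          have := approxError_nonneg n
          gcongr
      _ = (C₁ + C₂) / √n * Real.exp (-z ^ 2 / 4) := by
          simp only [C₁, C₂, approxError]; ring
      _ ≤ _ := hbig _ (by linarith)

theorem rpow_mul_exp_neg_le {p : ℝ} (hp : 0 < p) {y : ℝ} (hy : 0 ≤ y) :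
    y ^ p * Real.exp (-y ^ 2 / 8) ≤ 2 ^ p * p ^ (p / 2) := by
  have h1 : y ^ 2 / (4 * p) ≤ Real.exp (y ^ 2 / (4 * p)) := by
    linarith [Real.add_one_le_exp (y ^ 2 / (4 * p))]
  have h2 := Real.rpow_le_rpow (by positivity) h1 (by positivity : 0 ≤ p / 2)
  rw [← Real.exp_mul, Real.div_rpow (by positivity) (by positivity), ← Real.rpow_natCast,
    ← Real.rpow_mul hy, Real.mul_rpow (by norm_num) hp.le,
    show (4 : ℝ) = 2 ^ (2 : ℝ) by norm_num, ← Real.rpow_mul (by norm_num),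
    div_le_iff₀ (by positivity)] at h2
  have e1 : ((2 : ℕ) : ℝ) * (p / 2) = p := by push_cast; ring
  have e2 : (2 : ℝ) * (p / 2) = p := by ring
  have e3 : y ^ ((2 : ℕ) : ℝ) / ((2 : ℝ) ^ (2 : ℝ) * p) * (p / 2) = y ^ 2 / 8 := by
    rw [Real.rpow_natCast]
    norm_num
    field_simp
    ring
  rw [e1, e2, e3] at h2
  rw [neg_div, Real.exp_neg, ← div_eq_mul_inv, div_le_iff₀ (Real.exp_pos _)]
  linarith

theorem exists_weighted_cdf_bound : ∃ B : ℝ, 0 < B ∧ ∀ n : ℕ, 1 ≤ n → ∀ p : ℝ, 1 ≤ p →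
    ∀ z : ℝ, |(criticalMeasure n).real {σ | W σ ≤ z} - limitLaw.real (Set.Iic z)| ≤
      B ^ p * p ^ (p / 2) / ((1 + |z|) ^ p * (n : ℝ) ^ (1 / 2 : ℝ)) := by
  obtain ⟨C, hC, h⟩ := exists_cdf_bound
  set D := max 1 (C * Real.exp (1 / 4))
  have hD1 : 1 ≤ D := le_max_left _ _
  refine ⟨2 * D, by positivity, fun n hn p hp z => (h n hn z).trans ?_⟩
  have hr := one_le_sqrt_natCast hn
  have hz := abs_nonneg z
  have hy : 0 < (1 + |z|) ^ p := Real.rpow_pos_of_pos (by linarith) _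
  rw [← Real.sqrt_eq_rpow, div_mul_eq_mul_div, div_le_div_iff₀ (by linarith) (by positivity)]
  have h1 : Real.exp (-z ^ 2 / 4) ≤ Real.exp (1 / 4) * Real.exp (-(1 + |z|) ^ 2 / 8) := by
    rw [← Real.exp_add, Real.exp_le_exp, ← sq_abs z]
    nlinarith [sq_nonneg (|z| - 1)]
  have h2 := rpow_mul_exp_neg_le (by linarith : 0 < p) (by linarith : 0 ≤ 1 + |z|)
  have h3 : C * Real.exp (1 / 4) ≤ D ^ p :=
    (le_max_right _ _).trans (Real.self_le_rpow_of_one_le hD1 hp)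
  rw [Real.mul_rpow (by norm_num) (by linarith)]
  calc C * Real.exp (-z ^ 2 / 4) * ((1 + |z|) ^ p * √n)
      ≤ C * (Real.exp (1 / 4) * Real.exp (-(1 + |z|) ^ 2 / 8)) * ((1 + |z|) ^ p * √n) := by gcongr
    _ = C * Real.exp (1 / 4) * ((1 + |z|) ^ p * Real.exp (-(1 + |z|) ^ 2 / 8)) * √n := by ring
    _ ≤ D ^ p * (2 ^ p * p ^ (p / 2)) * √n := by gcongr
    _ = _ := by ring

/-! ### Moments -/

theorem integral_criticalMeasure_W {n : ℕ} (hn : 1 ≤ n) (f : ℝ → ℝ) :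
    ∫ σ : Config n, f (W σ) ∂(criticalMeasure n) =
      (∑ k ∈ Finset.range (n + 1), relWeight n k * f (level n k)) /
        ∑ k ∈ Finset.range (n + 1), relWeight n k := by
  have h := integral_criticalMeasure hn fun s => f (s / scale n)
  simp only [relWeight, div_mul_eq_mul_div, ← Finset.sum_div]
  rw [div_div_div_cancel_right₀ (centralWeight_pos n).ne']
  exact h

theorem geom_sum_exp_le {N : ℝ} (hN : 0 < N) (m : ℕ) :
    ∑ i ∈ Finset.range m, Real.exp (-(i / N)) ≤ 1 + N := by
  set x := Real.exp (-(1 / N))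
  have hx0 : 0 < x := Real.exp_pos _
  have hx : x * (1 + 1 / N) ≤ 1 := by
    have h := Real.add_one_le_exp (1 / N)
    have : x * Real.exp (1 / N) = 1 := by rw [← Real.exp_add]; simp
    nlinarith
  have hpow : ∀ i : ℕ, Real.exp (-(i / N)) = x ^ i := fun i => by
    rw [← Real.exp_nat_mul]; congr 1; ring
  simp only [hpow]
  have h := geom_sum_mul_neg x m
  have h2 : (∑ i ∈ Finset.range m, x ^ i) * (1 - x) ≤ 1 := by
    rw [h]; linarith [pow_pos hx0 m]
  have h3 : 1 ≤ (1 + N) * (1 - x) := by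
    have : x * (1 + 1 / N) * N ≤ 1 * N := by gcongr
    have e : x * (1 + 1 / N) * N = x * (N + 1) := by field_simp
    rw [e] at this
    linarith
  have h4 : 0 < 1 - x := by
    have : x * (1 / N) > 0 := by positivity
    linarith
  exact le_of_mul_le_mul_right (h2.trans h3) h4

/-- On each side of the centre, the sum is dominated by a geometric series of ratio
`exp (-1 / scale n)`. -/
theorem sum_exp_neg_abs_level_le {n : ℕ} (hn : 1 ≤ n) :
    ∑ k ∈ Finset.range (n + 1), Real.exp (-|level n k| / 2) ≤ 2 * (1 + scale n) := by
  have hsc := scale_pos hn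
  have key : ∀ (k i : ℕ), 2 * (i : ℝ) ≤ |2 * (k : ℝ) - n| →
      Real.exp (-|level n k| / 2) ≤ Real.exp (-(i / scale n)) := by
    intro k i h
    rw [Real.exp_le_exp, level, abs_div, abs_of_pos hsc, neg_div, neg_le_neg_iff, div_div,
      div_le_div_iff₀ hsc (by positivity)]
    nlinarith
  rw [← Finset.sum_range_add_sum_Ico _ (show (n + 1) / 2 ≤ n + 1 by omega),
    ← Finset.sum_range_reflect, Finset.sum_Ico_eq_sum_range, two_mul]
  refine add_le_add ((Finset.sum_le_sum fun i hi => key _ i ?_).trans (geom_sum_exp_le hsc _))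
    ((Finset.sum_le_sum fun i hi => key _ i ?_).trans (geom_sum_exp_le hsc _))
  · rw [Finset.mem_range] at hi
    have h : 2 * ((n + 1) / 2 - 1 - i) + 2 * i ≤ n := by omega
    have h' : 2 * (((n + 1) / 2 - 1 - i : ℕ) : ℝ) + 2 * i ≤ n := by exact_mod_cast h
    refine le_trans ?_ (neg_le_abs _)
    linarith
  · have h : n + 2 * i ≤ 2 * ((n + 1) / 2 + i) := by omega
    have h' : (n : ℝ) + 2 * i ≤ 2 * (((n + 1) / 2 + i : ℕ) : ℝ) := by exact_mod_cast h
    refine le_trans ?_ (le_abs_self _)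
    linarith

/-- This is `y ≤ exp (y - 1)` at `y = w⁴ / (12p)`, raised to the power `p / 2`. -/
theorem abs_rpow_le {p : ℝ} (hp : 0 < p) (w : ℝ) :
    |w| ^ (2 * p) ≤ (12 * p) ^ (p / 2) * Real.exp (-p / 2) * Real.exp (w ^ 4 / 24) := by
  have h1 : w ^ 4 / (12 * p) ≤ Real.exp (w ^ 4 / (12 * p) - 1) := by
    linarith [Real.add_one_le_exp (w ^ 4 / (12 * p) - 1)]
  have h2 := Real.rpow_le_rpow (by positivity) h1 (by positivity : 0 ≤ p / 2)
  have e1 : w ^ 4 = |w| ^ ((4 : ℕ) : ℝ) := by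
    rw [Real.rpow_natCast, (by decide : Even 4).pow_abs]
  rw [← Real.exp_mul, Real.div_rpow (by positivity) (by positivity),
    div_le_iff₀ (by positivity)] at h2
  have e2 : (w ^ 4 / (12 * p) - 1) * (p / 2) = -p / 2 + w ^ 4 / 24 := by
    field_simp; ring
  rw [e2, Real.exp_add] at h2
  have e3 : (w ^ 4) ^ (p / 2) = |w| ^ (2 * p) := by
    rw [e1, ← Real.rpow_mul (abs_nonneg w)]
    congr 1
    push_cast
    ring
  rw [e3] at h2
  linarith

/-- In terms of expectations: `E exp (W⁴ / 24) ≤ 8` for `n ≥ 60`. -/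
theorem sum_relWeight_mul_exp_le {n : ℕ} (hn : 60 ≤ n) :
    ∑ k ∈ Finset.range (n + 1), relWeight n k * Real.exp (level n k ^ 4 / 24) ≤
      8 * ∑ k ∈ Finset.range (n + 1), relWeight n k := by
  have hn1 : 1 ≤ n := by omega
  have hnR : (60 : ℝ) ≤ n := by exact_mod_cast hn
  have h7 : 7 ≤ √(n : ℝ) := by
    rw [Real.le_sqrt (by norm_num) (by positivity)]
    norm_num; linarith
  have hN : 20 ≤ scale n := by
    refine le_of_sq_le_sq ?_ (scale_pos hn1).le
    rw [scale_sq hn1]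
    nlinarith
  have hterm : ∀ k ∈ Finset.range (n + 1), relWeight n k * Real.exp (level n k ^ 4 / 24) ≤
      Real.exp (19 / 20) * Real.exp (-|level n k| / 2) := by
    intro k hk
    have h1 := relWeight_le hn1 (show k ≤ n by simpa [Nat.lt_succ_iff] using hk)
    refine (mul_le_mul_of_nonneg_right h1 (Real.exp_pos _).le).trans ?_
    rw [← Real.exp_add, ← Real.exp_add, Real.exp_le_exp]
    have h2 : level n k ^ 2 / √n ≤ level n k ^ 2 / 7 := by gcongr
    have e4 : level n k ^ 4 = |level n k| ^ 4 := ((by decide : Even 4).pow_abs _).symm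
    rw [← sq_abs] at h2
    rw [e4, ← sq_abs]
    generalize |level n k| = u at *
    -- The maximum of `u² / 7 - u⁴ / 24 + u / 2` is about `0.93`, attained near `u = 1.83`.
    nlinarith [sq_nonneg (u ^ 2 - 17 / 5), sq_nonneg (u - 183 / 100)]
  have hexp : Real.exp (19 / 20) ≤ 2.72 := by
    have := Real.exp_le_exp.2 (show (19 / 20 : ℝ) ≤ 1 by norm_num)
    linarith [Real.exp_one_lt_d9]
  have hden := sum_relWeight_ge (show 16 ≤ n by omega)
  calc _ ≤ ∑ k ∈ Finset.range (n + 1), Real.exp (19 / 20) * Real.exp (-|level n k| / 2) :=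
        Finset.sum_le_sum hterm
    _ ≤ 2.72 * (2 * (1 + scale n)) := by
        rw [← Finset.mul_sum]
        have := sum_exp_neg_abs_level_le hn1
        gcongr
    _ ≤ _ := by linarith

theorem integral_abs_W_rpow_le {n : ℕ} (hn : 1 ≤ n) {p : ℝ} (hp : 3 ≤ p) :
    ∫ σ, |W σ| ^ (2 * p) ∂(criticalMeasure n) ≤ (20 : ℝ) ^ (p / 2) * p ^ (p / 2) := by
  have hp0 : 0 < p := by linarith
  have hpos : ∀ k ∈ Finset.range (n + 1), 0 ≤ relWeight n k := fun k hk =>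
    (relWeight_pos (by simpa [Nat.lt_succ_iff] using hk)).le
  have hsum : 0 < ∑ k ∈ Finset.range (n + 1), relWeight n k :=
    Finset.sum_pos (fun k hk => relWeight_pos (by simpa [Nat.lt_succ_iff] using hk)) ⟨0, by simp⟩
  rw [integral_criticalMeasure_W hn fun w => |w| ^ (2 * p), div_le_iff₀ hsum,
    ← Real.mul_rpow (by norm_num) hp0.le]
  rcases le_or_gt (n : ℝ) (20 * p) with h | h
  · rw [Finset.mul_sum]
    refine Finset.sum_le_sum fun k hk => ?_
    rw [mul_comm]
    refine mul_le_mul_of_nonneg_right ?_ (hpos k hk)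
    have hkn : (k : ℝ) ≤ n := by
      exact_mod_cast (show k ≤ n by simpa [Nat.lt_succ_iff] using hk)
    have h4 : |level n k| ^ 4 ≤ n := by
      have hs : |2 * (k : ℝ) - n| ≤ n := by
        rw [abs_le]; constructor <;> linarith [Nat.cast_nonneg (α := ℝ) k]
      have hn0 : (0 : ℝ) < n := by exact_mod_cast hn
      have e : scale n ^ 4 = n ^ 3 := by
        rw [show scale n ^ 4 = (scale n ^ 2) ^ 2 by ring, scale_sq hn, mul_pow,
          Real.sq_sqrt hn0.le]
        ring
      rw [level, abs_div, abs_of_pos (scale_pos hn), div_pow, e, div_le_iff₀ (by positivity)]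
      calc _ ≤ (n : ℝ) ^ 4 := by gcongr
        _ = _ := by ring
    have e : |level n k| ^ (2 * p) = (|level n k| ^ 4) ^ (p / 2) := by
      rw [← Real.rpow_natCast, ← Real.rpow_mul (abs_nonneg _)]
      congr 1
      push_cast
      ring
    rw [e]
    exact Real.rpow_le_rpow (by positivity) (h4.trans h) (by positivity)
  · have hn60 : 60 ≤ n := by
      have : (60 : ℝ) ≤ n := by linarith
      exact_mod_cast this
    have hc : 8 * Real.exp (-p / 2) * (12 * p) ^ (p / 2) ≤ (20 * p) ^ (p / 2) := by
      have e1 : (20 * p) ^ (p / 2) = (5 / 3 : ℝ) ^ (p / 2) * (12 * p) ^ (p / 2) := by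
        rw [← Real.mul_rpow (by norm_num) (by positivity)]
        congr 1; ring
      rw [e1]
      refine mul_le_mul_of_nonneg_right ?_ (by positivity)
      have h8 : (8 : ℝ) ≤ 4 ^ (p / 2) := by
        calc (8 : ℝ) = (2 ^ (2 : ℝ)) ^ (3 / 2 : ℝ) := by
              rw [← Real.rpow_mul (by norm_num)]; norm_num
          _ = 4 ^ (3 / 2 : ℝ) := by norm_num
          _ ≤ _ := Real.rpow_le_rpow_of_exponent_le (by norm_num) (by linarith)
      have h4 : (4 : ℝ) ≤ 5 / 3 * Real.exp 1 := by linarith [Real.exp_one_gt_d9]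
      have h5 := h8.trans (Real.rpow_le_rpow (by norm_num) h4 (by positivity : 0 ≤ p / 2))
      rw [Real.mul_rpow (by norm_num) (Real.exp_pos _).le, Real.exp_one_rpow] at h5
      rw [neg_div, Real.exp_neg, ← div_eq_mul_inv, div_le_iff₀ (Real.exp_pos _)]
      exact h5
    calc _ ≤ ∑ k ∈ Finset.range (n + 1), (12 * p) ^ (p / 2) * Real.exp (-p / 2) *
          (relWeight n k * Real.exp (level n k ^ 4 / 24)) := by
          refine Finset.sum_le_sum fun k hk => ?_
          have := mul_le_mul_of_nonneg_left (abs_rpow_le hp0 (level n k)) (hpos k hk)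
          linarith
      _ ≤ (12 * p) ^ (p / 2) * Real.exp (-p / 2) *
          (8 * ∑ k ∈ Finset.range (n + 1), relWeight n k) := by
          rw [← Finset.mul_sum]
          have := sum_relWeight_mul_exp_le hn60
          gcongr
      _ = 8 * Real.exp (-p / 2) * (12 * p) ^ (p / 2) *
          ∑ k ∈ Finset.range (n + 1), relWeight n k := by ring
      _ ≤ _ := mul_le_mul_of_nonneg_right hc hsum.le

end CurieWeiss

end

theorem theorem4p1 :
    ∃ B : ℝ, 0 < B ∧ ∀ (n : ℕ), 1 ≤ n → ∀ p : ℝ, 3 ≤ p →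
      (∀ z : ℝ,
        |(CurieWeiss.criticalMeasure n).real {σ | CurieWeiss.W σ ≤ z}
            - CurieWeiss.limitLaw.real (Set.Iic z)|
          ≤ B ^ p * p ^ (p / 2) / ((1 + |z|) ^ p * (n : ℝ) ^ (1 / 2 : ℝ))) ∧
      ∫ σ, |CurieWeiss.W σ| ^ (2 * p) ∂(CurieWeiss.criticalMeasure n)
        ≤ (20 : ℝ) ^ (p / 2) * p ^ (p / 2) := by
  obtain ⟨B, hB, h⟩ := CurieWeiss.exists_weighted_cdf_bound
  exact ⟨B, hB, fun n hn p hp =>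
    ⟨h n hn p (by linarith), CurieWeiss.integral_abs_W_rpow_le hn hp⟩⟩
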